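/- Let $n$ be even and let $S$ be a set of $n$ points in the Euclidean plane, no three of which are collinear. A line through two points of $S$ is called a halving line if the two open half-planes it bounds contain equally many of the remaining $n-2$ points of $S$. The underlying graph of $S$ has the points of $S$ as its vertices, and two distinct points of $S$ are joined by an edge if and only if the line through them is a halving line. Let $P$ and $Q$ be distinct vertices of the underlying graph. Then $\deg P+\deg Q\le n$ if $PQ$ is an edge, and $\deg P+\deg Q\le n-2$ if $PQ$ is not an edge. -/

import Mathlib

/-- The Euclidean plane. -/
abbrev Plane : Type := EuclideanSpace ℝ (Fin 2)

/-- A finite planar point set is in general position if no three distinct points of it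
are collinear. -/
def GeneralPosition (S : Finset Plane) : Prop :=
  ∀ A ∈ S, ∀ B ∈ S, ∀ C ∈ S, A ≠ B → A ≠ C → B ≠ C → ¬ Collinear ℝ ({A, B, C} : Set Plane)

/-- The determinant of the vectors `B - A` and `X - A`. For `A ≠ B` it vanishes exactly when `X`
is on the line `AB`, and its sign tells on which side of the directed line `AB` the
point `X` lies. -/
def orient (A B X : Plane) : ℝ :=
  (B 0 - A 0) * (X 1 - A 1) - (B 1 - A 1) * (X 0 - A 0)

theorem orient_swap (A B X : Plane) : orient B A X = -orient A B X := by
  unfold orient; ring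

/-- The line through `A` and `B` is a halving line of `S`: `A` and `B` are distinct points of `S`,
and the two open sides of the line `AB` contain equally many points of `S`. -/
def IsHalvingLine (S : Finset Plane) (A B : Plane) : Prop :=
  A ∈ S ∧ B ∈ S ∧ A ≠ B ∧
    {X : Plane | X ∈ S ∧ 0 < orient A B X}.ncard = {X : Plane | X ∈ S ∧ orient A B X < 0}.ncard

theorem IsHalvingLine.swap {S : Finset Plane} {A B : Plane} (h : IsHalvingLine S A B) :
    IsHalvingLine S B A := by
  obtain ⟨hA, hB, hne, hc⟩ := h
  refine ⟨hB, hA, hne.symm, ?_⟩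
  simp only [orient_swap A B, Left.neg_pos_iff, Left.neg_neg_iff]
  exact hc.symm

/-- The underlying graph of a finite point set: its vertices are the points, and two of them are
joined by an edge iff the line through them is a halving line. -/
def underlyingGraph (S : Finset Plane) : SimpleGraph S where
  Adj P Q := IsHalvingLine S P Q
  symm := ⟨fun _ _ h => h.swap⟩
  loopless := ⟨fun _ h => h.2.2.1 rfl⟩

/-! Fix a linear form `g` injective on `S` and call its values heights. Rotate a line about a point
`X` and record each other point as +1 or -1 according to whether it is above or below `X`. The
partial sums form a walk, and `XY` is halving exactly when the step at `Y` passes half of the total.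
If fewer points are below `X` than above, the signed number of such steps is 1, so `X` has one more
halving partner above than below (`card_above_eq_card_below_add_one`). Summed over a set `R` of at
most `n/2` lowest points, edges inside `R` cancel, so exactly `|R|` halving edges leave `R`
(`card_crossing_halving`).

For the theorem, turn the line `PQ` slightly, so that `P` and `Q` become consecutive heights and `R`
is the smaller open side of `PQ`. At most `|R|` edges join `R` to `P` or `Q`, and the one-partner
imbalance at `P` and at `Q` converts this into a bound on the degrees. -/

theorem collinear_of_orient_eq_zero {A B X : Plane} (hAB : A ≠ B) (h : orient A B X = 0) :
    Collinear ℝ ({A, B, X} : Set Plane) := by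
  rw [collinear_iff_of_mem (p₀ := A) (by simp)]
  unfold orient at h
  have hX : ∃ r : ℝ, X = r • (B - A) +ᵥ A := by
    by_cases h0 : B 0 - A 0 = 0
    · have h1 : B 1 - A 1 ≠ 0 := by
        intro h1
        apply hAB
        ext i
        fin_cases i
        · simp; linarith
        · simp; linarith
      refine ⟨(X 1 - A 1) / (B 1 - A 1), ?_⟩
      have h2 : X 0 - A 0 = 0 := by
        rw [h0, zero_mul, zero_sub, neg_eq_zero] at h
        exact (mul_eq_zero.mp h).resolve_left h1
      ext i
      fin_cases i
      · simp [h0]; linarith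
      · simp; field_simp; ring
    · refine ⟨(X 0 - A 0) / (B 0 - A 0), ?_⟩
      ext i
      fin_cases i
      · simp; field_simp; ring
      · simp; field_simp; linarith
  refine ⟨B - A, ?_⟩
  intro p hp
  simp only [Set.mem_insert_iff, Set.mem_singleton_iff] at hp
  rcases hp with rfl | rfl | rfl
  · exact ⟨0, by simp⟩
  · exact ⟨1, by simp⟩
  · exact hX

theorem GeneralPosition.orient_ne_zero {S : Finset Plane} (hS : GeneralPosition S) {A B X : Plane}
    (hA : A ∈ S) (hB : B ∈ S) (hX : X ∈ S) (hAB : A ≠ B) (hAX : A ≠ X) (hBX : B ≠ X) :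
    orient A B X ≠ 0 :=
  fun h => hS A hA B hB X hX hAB hAX hBX (collinear_of_orient_eq_zero hAB h)

/-! ### Signed crossings of a ±1 walk -/

/-- A telescoping sum over a finite set ordered by an injective function. -/
theorem sum_telescope_filter_lt {ι : Type*} [DecidableEq ι] (t : ι → ℝ) (s φ : ι → ℤ) (ψ : ℤ → ℤ)
    (I : Finset ι) (ht : Set.InjOn t I)
    (hφ : ∀ i ∈ I, φ i = ψ (∑ j ∈ I with t j < t i, s j + s i) - ψ (∑ j ∈ I with t j < t i, s j)) :
    ∑ i ∈ I, φ i = ψ (∑ i ∈ I, s i) - ψ 0 := by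
  -- Inserting an element with the largest `t` changes no earlier prefix, and its own prefix is all
  -- of `I`.
  induction I using Finset.induction_on_max_value t with
  | empty => simp
  | insert a I ha hmax ih =>
    have hlt : ∀ i ∈ I, t i < t a := fun i hi => lt_of_le_of_ne (hmax i hi) fun h =>
      ha (ht (by simp [hi]) (by simp) h ▸ hi)
    have hfa : (insert a I).filter (fun j => t j < t a) = I := by
      ext j
      simp only [Finset.mem_filter, Finset.mem_insert]
      constructor
      · rintro ⟨rfl | h, h'⟩
        · exact absurd h' (lt_irrefl _)
        · exact h
      · exact fun h => ⟨Or.inr h, hlt j h⟩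
    have hfi : ∀ i ∈ I, (insert a I).filter (fun j => t j < t i) =
        I.filter (fun j => t j < t i) := by
      intro i hi
      rw [Finset.filter_insert, if_neg (not_lt.mpr (hlt i hi).le)]
    have h1 := ih (ht.mono (by simp)) (fun i hi => by
      have := hφ i (by simp [hi])
      rwa [hfi i hi] at this)
    have h2 := hφ a (by simp)
    rw [hfa] at h2
    rw [Finset.sum_insert ha, Finset.sum_insert ha, h1, h2, add_comm (s a)]
    ring

/-- The steps of a `±1` walk from `0` to an odd `T > 0` that pass through `T / 2` sum up to `1`. -/
theorem sum_half_crossing {ι : Type*} [DecidableEq ι] (t : ι → ℝ) (s : ι → ℤ) (I : Finset ι)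
    (ht : Set.InjOn t I) (hs : ∀ i ∈ I, s i = 1 ∨ s i = -1) (hpos : 0 < ∑ i ∈ I, s i)
    (hodd : Odd (∑ i ∈ I, s i)) :
    ∑ i ∈ I with 2 * (∑ j ∈ I with t j < t i, s j) + s i = ∑ j ∈ I, s j, s i = 1 := by
  set T := ∑ i ∈ I, s i with hT
  obtain ⟨k, hk⟩ := hodd
  rw [Finset.sum_filter]
  -- `ψ` indicates the positions beyond `T / 2`, which no position equals because `T` is odd. It
  -- changes only at a crossing, by the sign of the step.
  rw [sum_telescope_filter_lt t s _ (fun x => if T < 2 * x then 1 else 0) I ht]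
  · rw [← hT, if_pos (by omega), if_neg (by omega)]
    norm_num
  · intro i hi
    rcases hs i hi with h | h <;> rw [h] <;> split_ifs <;> omega

/-! ### Halving lines through a point as crossings -/

/-- The linear form with coefficients `α`, `β`. -/
def linForm (α β : ℝ) (Y : Plane) : ℝ := α * Y 0 + β * Y 1

theorem linForm_neg (α β : ℝ) (Y : Plane) : linForm (-α) (-β) Y = -linForm α β Y := by
  unfold linForm; ring

theorem sum_sign_eq {ι : Type*} (I : Finset ι) (f : ι → ℝ) :
    ∑ i ∈ I, (SignType.sign (f i) : ℤ) =
      ((I.filter fun i => 0 < f i).card : ℤ) - (I.filter fun i => f i < 0).card := by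
  rw [Finset.card_filter, Finset.card_filter]
  push_cast
  rw [← Finset.sum_sub_distrib]
  refine Finset.sum_congr rfl fun i _ => ?_
  rcases lt_trichotomy (f i) 0 with h | h | h
  · simp [h, not_lt.mpr h.le]
  · simp [h]
  · simp [h, not_lt.mpr h.le]

theorem isHalvingLine_iff_sum_sign {S : Finset Plane} {A B : Plane} (hA : A ∈ S) (hB : B ∈ S)
    (hAB : A ≠ B) :
    IsHalvingLine S A B ↔ ∑ X ∈ S, (SignType.sign (orient A B X) : ℤ) = 0 := by
  have h1 : {X : Plane | X ∈ S ∧ 0 < orient A B X} =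
      ↑(S.filter fun X => 0 < orient A B X) := by ext; simp
  have h2 : {X : Plane | X ∈ S ∧ orient A B X < 0} =
      ↑(S.filter fun X => orient A B X < 0) := by ext; simp
  rw [IsHalvingLine, h1, h2, Set.ncard_coe_finset, Set.ncard_coe_finset, sum_sign_eq]
  constructor
  · rintro ⟨-, -, -, h⟩
    omega
  · intro h
    exact ⟨hA, hB, hAB, by omega⟩

/-- The walk criterion for a halving line through `X`: the points are read in the order of the
slopes `t` of their connecting lines with `X`, and `s` is the side of the horizontal through `X`. -/
theorem isHalvingLine_iff_walk {S : Finset Plane} {X Y : Plane} (hX : X ∈ S) (hY : Y ∈ S)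
    (hXY : X ≠ Y) (t : Plane → ℝ) (s : Plane → ℤ) (ht : Set.InjOn t (S.erase X))
    (hsY : s Y = 1 ∨ s Y = -1)
    (hor : ∀ Z ∈ S.erase X,
      (SignType.sign (orient X Y Z) : ℤ) = s Y * (s Z * SignType.sign (t Z - t Y))) :
    IsHalvingLine S X Y ↔ 2 * (∑ Z ∈ S.erase X with t Z < t Y, s Z) + s Y =
      ∑ Z ∈ S.erase X, s Z := by
  have hYI : Y ∈ S.erase X := Finset.mem_erase.mpr ⟨hXY.symm, hY⟩
  have hX0 : (SignType.sign (orient X Y X) : ℤ) = 0 := by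
    have : orient X Y X = 0 := by unfold orient; ring
    simp [this]
  rw [isHalvingLine_iff_sum_sign hX hY hXY, ← Finset.add_sum_erase S _ hX, hX0, zero_add,
    Finset.sum_congr rfl hor, ← Finset.mul_sum]
  -- Points before `Y` count with factor -1, points after it with +1, and `Y` itself with 0.
  have key : ∑ Z ∈ S.erase X, s Z * (SignType.sign (t Z - t Y) : ℤ) =
      ∑ Z ∈ S.erase X, s Z - 2 * (∑ Z ∈ S.erase X with t Z < t Y, s Z) - s Y := by
    have hs : s Y = ∑ Z ∈ S.erase X, if Z = Y then s Z else 0 := by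
      rw [Finset.sum_ite_eq' (S.erase X) Y s, if_pos hYI]
    rw [hs, Finset.sum_filter, Finset.mul_sum, ← Finset.sum_sub_distrib, ← Finset.sum_sub_distrib]
    refine Finset.sum_congr rfl fun Z hZ => ?_
    rcases lt_trichotomy (t Z) (t Y) with h | h | h
    · have hne : Z ≠ Y := fun e => h.ne (e ▸ rfl)
      rw [sign_neg (sub_neg.mpr h), if_pos h, if_neg hne]
      simp; ring
    · have e : Z = Y := ht hZ hYI h
      subst e
      simp
    · have hne : Z ≠ Y := fun e => h.ne (e ▸ rfl)
      rw [sign_pos (sub_pos.mpr h), if_neg (not_lt.mpr h.le), if_neg hne]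
      simp
  rw [key]
  rcases hsY with h | h <;> rw [h] <;> constructor <;> intro h' <;> linarith

/-! ### Imbalance of halving partners above and below a point -/

open Classical in
/-- If fewer points of `S` lie below `X` than above it, the halving lines through `X` have one
more partner above `X` than below it. -/
theorem card_above_eq_card_below_add_one {S : Finset Plane} (hS : GeneralPosition S)
    (hn : Even S.card) {α β : ℝ} (hg : Set.InjOn (linForm α β) S) {X : Plane} (hX : X ∈ S)
    (hlow : 2 * (S.filter fun Y => linForm α β Y < linForm α β X).card + 1 < S.card) :
    (S.filter fun Y => IsHalvingLine S X Y ∧ linForm α β X < linForm α β Y).card =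
      (S.filter fun Y => IsHalvingLine S X Y ∧ linForm α β Y < linForm α β X).card + 1 := by
  set g := linForm α β with hgdef
  -- `h` is `g` turned by a right angle, so `t` is the slope from `X` in the coordinates `(g, h)`;
  -- sorting by `t` is the order in which a rotating line through `X` meets the points.
  set h := linForm (-β) α with hhdef
  set t : Plane → ℝ := fun Y => (h Y - h X) / (g Y - g X) with ht
  set s : Plane → ℤ := fun Y => (SignType.sign (g Y - g X) : ℤ) with hs
  have hne : ∀ Y ∈ S.erase X, g Y - g X ≠ 0 := fun Y hY e =>
    (Finset.mem_erase.mp hY).1 (hg (Finset.mem_of_mem_erase hY) hX (sub_eq_zero.mp e))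
  have horient : ∀ Y ∈ S.erase X, ∀ Z ∈ S.erase X,
      (α ^ 2 + β ^ 2) * orient X Y Z = (g Y - g X) * ((g Z - g X) * (t Z - t Y)) := by
    intro Y hY Z hZ
    have h1 := hne Y hY
    have h2 := hne Z hZ
    have : (g Y - g X) * ((g Z - g X) * (t Z - t Y)) =
        (g Y - g X) * (h Z - h X) - (g Z - g X) * (h Y - h X) := by
      simp only [ht]; field_simp
    rw [this]
    simp only [hgdef, hhdef, linForm, orient]
    ring
  have hcard : 1 < S.card := by omega
  have hαβ : 0 < α ^ 2 + β ^ 2 := by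
    obtain ⟨Y, hY, hYX⟩ := Finset.exists_mem_ne hcard X
    have h1 := hne Y (Finset.mem_erase.mpr ⟨hYX, hY⟩)
    by_contra hc
    have hα : α = 0 := by nlinarith [sq_nonneg α, sq_nonneg β]
    have hβ : β = 0 := by nlinarith [sq_nonneg α, sq_nonneg β]
    apply h1
    simp [hgdef, linForm, hα, hβ]
  have htinj : Set.InjOn t (S.erase X) := by
    intro Y hY Z hZ e
    by_contra hYZ
    have h1 := horient Y hY Z hZ
    rw [e, sub_self, mul_zero, mul_zero] at h1
    have hY' := Finset.mem_erase.mp hY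
    have hZ' := Finset.mem_erase.mp hZ
    exact hS.orient_ne_zero hX hY'.2 hZ'.2 hY'.1.symm hZ'.1.symm hYZ
      ((mul_eq_zero.mp h1).resolve_left hαβ.ne')
  have hs1 : ∀ Y ∈ S.erase X, s Y = 1 ∨ s Y = -1 := by
    intro Y hY
    rcases lt_or_gt_of_ne (hne Y hY) with h | h
    · right; simp only [hs]; rw [sign_neg h]; rfl
    · left; simp only [hs]; rw [sign_pos h]; rfl
  have hwalk : ∀ Y ∈ S.erase X, (IsHalvingLine S X Y ↔
      2 * (∑ Z ∈ S.erase X with t Z < t Y, s Z) + s Y = ∑ Z ∈ S.erase X, s Z) := by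
    intro Y hY
    have hY' := Finset.mem_erase.mp hY
    refine isHalvingLine_iff_walk hX hY'.2 hY'.1.symm t s htinj (hs1 Y hY) fun Z hZ => ?_
    have h1 := congrArg SignType.sign (horient Y hY Z hZ)
    rw [sign_mul, sign_pos hαβ, one_mul, sign_mul, sign_mul] at h1
    rw [h1]
    simp only [hs]
    push_cast
    rfl
  have hlow_eq : ((S.erase X).filter fun Y => g Y - g X < 0) = S.filter fun Y => g Y < g X := by
    ext Y
    simp only [Finset.mem_filter, Finset.mem_erase, sub_neg]
    exact ⟨fun h => ⟨h.1.2, h.2⟩, fun h => ⟨⟨fun e => h.2.ne (e ▸ rfl), h.1⟩, h.2⟩⟩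
  have hsplit : ((S.erase X).filter fun Y => 0 < g Y - g X).card +
      ((S.erase X).filter fun Y => g Y - g X < 0).card + 1 = S.card := by
    rw [← Finset.card_erase_add_one hX, ← Finset.card_filter_add_card_filter_not
      (s := S.erase X) (fun Y => 0 < g Y - g X)]
    congr 3
    refine Finset.filter_congr fun Y hY => ?_
    rw [not_lt]
    exact ⟨le_of_lt, fun h => lt_of_le_of_ne h (hne Y hY)⟩
  have hT : ∑ Z ∈ S.erase X, s Z = ((S.erase X).filter fun Y => 0 < g Y - g X).card -
      ((S.erase X).filter fun Y => g Y - g X < 0).card := sum_sign_eq _ _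
  rw [← hlow_eq] at hlow
  obtain ⟨m, hm⟩ := hn
  -- With `b` points below `X`, the total is `n - 1 - 2b`: positive by `hlow`, and odd since `n` is
  -- even.
  have hmain := sum_half_crossing t s (S.erase X) htinj hs1 (by rw [hT]; omega)
    (by
      rw [hT]
      exact ⟨(m : ℤ) - 1 - ((S.erase X).filter fun Y => g Y - g X < 0).card, by omega⟩)
  rw [Finset.filter_congr fun Y hY => (hwalk Y hY).symm, sum_sign_eq, Finset.filter_filter,
    Finset.filter_filter] at hmain
  have hup : ((S.erase X).filter fun Y => IsHalvingLine S X Y ∧ 0 < g Y - g X) =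
      S.filter fun Y => IsHalvingLine S X Y ∧ g X < g Y := by
    ext Y
    simp only [Finset.mem_filter, Finset.mem_erase, sub_pos]
    exact ⟨fun h => ⟨h.1.2, h.2⟩, fun h => ⟨⟨h.2.1.2.2.1.symm, h.1⟩, h.2⟩⟩
  have hdown : ((S.erase X).filter fun Y => IsHalvingLine S X Y ∧ g Y - g X < 0) =
      S.filter fun Y => IsHalvingLine S X Y ∧ g Y < g X := by
    ext Y
    simp only [Finset.mem_filter, Finset.mem_erase, sub_neg]
    exact ⟨fun h => ⟨h.1.2, h.2⟩, fun h => ⟨⟨h.2.1.2.2.1.symm, h.1⟩, h.2⟩⟩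
  rw [hup, hdown] at hmain
  omega

theorem card_lt_add_card_gt {S : Finset Plane} {g : Plane → ℝ} (hg : Set.InjOn g S) {X : Plane}
    (hX : X ∈ S) : (S.filter fun Y => g Y < g X).card + (S.filter fun Y => g X < g Y).card + 1 =
      S.card := by
  rw [← Finset.card_erase_add_one hX, ← Finset.card_filter_add_card_filter_not
    (s := S.erase X) (fun Y => g Y < g X)]
  congr 3
  · ext Y
    simp only [Finset.mem_filter, Finset.mem_erase]
    exact ⟨fun h => ⟨⟨fun e => h.2.ne (e ▸ rfl), h.1⟩, h.2⟩, fun h => ⟨h.1.2, h.2⟩⟩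
  · ext Y
    simp only [Finset.mem_filter, Finset.mem_erase, not_lt]
    exact ⟨fun h => ⟨⟨fun e => h.2.ne (e ▸ rfl), h.1⟩, h.2.le⟩,
      fun h => ⟨h.1.2, lt_of_le_of_ne h.2 fun e => h.1.1 (hg h.1.2 hX e.symm)⟩⟩

-- Negating the form exchanges above and below.
open Classical in
theorem card_below_eq_card_above_add_one {S : Finset Plane} (hS : GeneralPosition S)
    (hn : Even S.card) {α β : ℝ} (hg : Set.InjOn (linForm α β) S) {X : Plane} (hX : X ∈ S)
    (hlow : S.card < 2 * (S.filter fun Y => linForm α β Y < linForm α β X).card + 1) :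
    (S.filter fun Y => IsHalvingLine S X Y ∧ linForm α β Y < linForm α β X).card =
      (S.filter fun Y => IsHalvingLine S X Y ∧ linForm α β X < linForm α β Y).card + 1 := by
  have hsum := card_lt_add_card_gt hg hX
  have := card_above_eq_card_below_add_one hS hn (α := -α) (β := -β)
    (fun Y hY Z hZ e => hg hY hZ (by simpa [linForm_neg] using e)) hX
  simp only [linForm_neg, neg_lt_neg_iff] at this
  exact this (by omega)

open Classical in
-- Halving edges across a level line
/-- A line with at most half of the points below it crosses as many halving segments as there are
points below it. -/
theorem card_crossing_halving {S : Finset Plane} (hS : GeneralPosition S)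
    (hn : Even S.card) {α β : ℝ} (hg : Set.InjOn (linForm α β) S) (c : ℝ)
    (hc : 2 * (S.filter fun Y => linForm α β Y < c).card ≤ S.card) :
    ∑ Y ∈ S with linForm α β Y < c,
      (S.filter fun Z => IsHalvingLine S Y Z ∧ c ≤ linForm α β Z).card =
    (S.filter fun Y => linForm α β Y < c).card := by
  set g := linForm α β with hgdef
  set R := S.filter fun Y => g Y < c with hR
  -- All points lower than `Y` lie in `R` and there are at most `|R| - 1` of them, so the imbalance
  -- applies at `Y`; its upper partners are split at height `c`.
  have hstep : ∀ Y ∈ R, (S.filter fun Z => IsHalvingLine S Y Z ∧ c ≤ g Z).card +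
      (R.filter fun Z => IsHalvingLine S Y Z ∧ g Y < g Z).card =
      (R.filter fun Z => IsHalvingLine S Y Z ∧ g Z < g Y).card + 1 := by
    intro Y hY
    obtain ⟨hYS, hYc⟩ := Finset.mem_filter.mp hY
    have hsub : (S.filter fun Z => g Z < g Y) ⊂ R := by
      rw [Finset.ssubset_iff_of_subset]
      · exact ⟨Y, hY, by simp⟩
      · intro Z hZ
        obtain ⟨h1, h2⟩ := Finset.mem_filter.mp hZ
        exact Finset.mem_filter.mpr ⟨h1, h2.trans hYc⟩
    have hlt := Finset.card_lt_card hsub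
    have h1 := card_above_eq_card_below_add_one hS hn hg hYS (by rw [← hgdef]; omega)
    rw [← hgdef] at h1
    have h2 : (S.filter fun Z => IsHalvingLine S Y Z ∧ g Z < g Y) =
        R.filter fun Z => IsHalvingLine S Y Z ∧ g Z < g Y := by
      ext Z
      simp only [hR, Finset.mem_filter]
      exact ⟨fun h => ⟨⟨h.1, h.2.2.trans hYc⟩, h.2⟩, fun h => ⟨h.1.1, h.2⟩⟩
    rw [← h2, ← h1, ← Finset.card_filter_add_card_filter_not
      (s := S.filter fun Z => IsHalvingLine S Y Z ∧ g Y < g Z) (fun Z => c ≤ g Z)]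
    congr 2
    · ext Z
      simp only [Finset.mem_filter]
      exact ⟨fun h => ⟨⟨h.1, h.2.1, hYc.trans_le h.2.2⟩, h.2.2⟩,
        fun h => ⟨h.1.1, h.1.2.1, h.2⟩⟩
    · ext Z
      simp only [hR, Finset.mem_filter, not_le]
      exact ⟨fun h => ⟨⟨h.1.1, h.2⟩, h.1.2⟩, fun h => ⟨⟨h.1.1, h.2⟩, h.1.2⟩⟩
  -- Each halving edge inside `R` is counted once from its lower and once from its upper end.
  have hdouble : ∑ Y ∈ R, (R.filter fun Z => IsHalvingLine S Y Z ∧ g Y < g Z).card =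
      ∑ Y ∈ R, (R.filter fun Z => IsHalvingLine S Y Z ∧ g Z < g Y).card := by
    have h := Finset.sum_card_bipartiteAbove_eq_sum_card_bipartiteBelow (s := R) (t := R)
      (fun Y Z => IsHalvingLine S Y Z ∧ g Y < g Z)
    simp only [Finset.bipartiteAbove, Finset.bipartiteBelow] at h
    rw [h]
    refine Finset.sum_congr rfl fun Y _ => congrArg Finset.card (Finset.filter_congr fun Z _ => ?_)
    exact and_congr_left fun _ => ⟨IsHalvingLine.swap, IsHalvingLine.swap⟩
  have hsum := Finset.sum_congr rfl hstep
  rw [Finset.sum_add_distrib, Finset.sum_add_distrib, hdouble, Finset.sum_const, smul_eq_mul,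
    mul_one] at hsum
  omega

/-! ### Perturbing the line through two points -/

open Filter Topology in
theorem eventually_add_mul_pos {a : ℝ} (b : ℝ) (ha : 0 < a) : ∀ᶠ ε in 𝓝[>] (0 : ℝ), 0 < a + ε * b := by
  have h : Tendsto (fun ε : ℝ => a + ε * b) (𝓝 0) (𝓝 (a + 0 * b)) :=
    (Continuous.tendsto (by fun_prop) 0)
  rw [zero_mul, add_zero] at h
  exact nhdsWithin_le_nhds (h.eventually (lt_mem_nhds ha))

open Filter Topology in
theorem eventually_add_mul_ne_zero {a b : ℝ} (h : ¬ (a = 0 ∧ b = 0)) :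
    ∀ᶠ ε in 𝓝[>] (0 : ℝ), a + ε * b ≠ 0 := by
  rcases lt_trichotomy a 0 with ha | ha | ha
  · filter_upwards [eventually_add_mul_pos (-b) (neg_pos.mpr ha)] with ε hε
    intro e
    linarith
  · filter_upwards [self_mem_nhdsWithin] with ε hε
    rw [ha, zero_add]
    exact mul_ne_zero (ne_of_gt hε) fun hb => h ⟨ha, hb⟩
  · filter_upwards [eventually_add_mul_pos b ha] with ε hε
    exact hε.ne'

open Filter Topology in
/-- Turning the line `PQ` slightly gives a linear form that separates all points of `S` and has
`P` and `Q` as consecutive values. -/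
theorem exists_linForm_separating {S : Finset Plane} (hS : GeneralPosition S) {P Q : Plane}
    (hP : P ∈ S) (hQ : Q ∈ S) (hPQ : P ≠ Q) :
    ∃ α β : ℝ, Set.InjOn (linForm α β) S ∧ linForm α β P < linForm α β Q ∧
      (∀ Y ∈ S, linForm α β Y < linForm α β P ↔ orient P Q Y < 0) ∧
      (∀ Y ∈ S, linForm α β Y < linForm α β Q ↔ Y = P ∨ orient P Q Y < 0) := by
  set u := Q 0 - P 0 with hu
  set v := Q 1 - P 1 with hv
  have huv : 0 < u ^ 2 + v ^ 2 := by
    by_contra hc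
    have h0 : u = 0 := by nlinarith [sq_nonneg u, sq_nonneg v]
    have h1 : v = 0 := by nlinarith [sq_nonneg u, sq_nonneg v]
    apply hPQ
    ext i
    fin_cases i
    · simp; linarith
    · simp; linarith
  -- At `ε = 0` the form is `orient P Q` up to a constant, and `P`, `Q` tie. The `ε` term is the
  -- inner product with `Q - P`, which puts `Q` above `P`.
  have hform : ∀ (ε : ℝ) (Y Z : Plane), linForm (-v + ε * u) (u + ε * v) Y -
      linForm (-v + ε * u) (u + ε * v) Z = (orient P Q Y - orient P Q Z) +
        ε * (u * (Y 0 - Z 0) + v * (Y 1 - Z 1)) := by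
    intro ε Y Z
    simp only [linForm, orient, ← hu, ← hv]
    ring
  have hoP : orient P Q P = 0 := by unfold orient; ring
  have hoQ : orient P Q Q = 0 := by unfold orient; ring
  have hinj : ∀ᶠ ε in 𝓝[>] (0 : ℝ), ∀ Y ∈ S, ∀ Z ∈ S, Y ≠ Z →
      (orient P Q Y - orient P Q Z) + ε * (u * (Y 0 - Z 0) + v * (Y 1 - Z 1)) ≠ 0 := by
    refine (eventually_all_finset S).mpr fun Y _ => (eventually_all_finset S).mpr fun Z _ => ?_
    by_cases hYZ : Y = Z
    · simp [hYZ]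
    · refine (eventually_add_mul_ne_zero ?_).mono fun _ h _ => h
      rintro ⟨h1, h2⟩
      have h1' : u * (Y 1 - Z 1) - v * (Y 0 - Z 0) = 0 := by
        rw [← h1]; simp only [orient, ← hu, ← hv]; ring
      have e0 : (u ^ 2 + v ^ 2) * (Y 0 - Z 0) = 0 := by linear_combination u * h2 - v * h1'
      have e1 : (u ^ 2 + v ^ 2) * (Y 1 - Z 1) = 0 := by linear_combination v * h2 + u * h1'
      have e0' := (mul_eq_zero.mp e0).resolve_left huv.ne'
      have e1' := (mul_eq_zero.mp e1).resolve_left huv.ne'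
      apply hYZ
      ext i
      fin_cases i
      · simp; linarith
      · simp; linarith
  -- Negative points must stay below `P`, the lower of the two; positive points must stay above `Q`.
  have hneg : ∀ᶠ ε in 𝓝[>] (0 : ℝ), ∀ Y ∈ S, orient P Q Y < 0 →
      0 < -orient P Q Y + ε * -(u * (Y 0 - P 0) + v * (Y 1 - P 1)) := by
    refine (eventually_all_finset S).mpr fun Y _ => ?_
    by_cases h : orient P Q Y < 0
    · exact (eventually_add_mul_pos _ (neg_pos.mpr h)).mono fun _ h _ => h
    · simp [h]
  have hpos : ∀ᶠ ε in 𝓝[>] (0 : ℝ), ∀ Y ∈ S, 0 < orient P Q Y →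
      0 < orient P Q Y + ε * (u * (Y 0 - Q 0) + v * (Y 1 - Q 1)) := by
    refine (eventually_all_finset S).mpr fun Y _ => ?_
    by_cases h : 0 < orient P Q Y
    · exact (eventually_add_mul_pos _ h).mono fun _ h _ => h
    · simp [h]
  obtain ⟨ε, h1, h2, h3, hε⟩ :=
    (hinj.and (hneg.and (hpos.and self_mem_nhdsWithin))).exists
  have hε : 0 < ε := hε
  have hlt : linForm (-v + ε * u) (u + ε * v) P < linForm (-v + ε * u) (u + ε * v) Q := by
    have := hform ε Q P
    rw [hoP, hoQ, ← hu, ← hv] at this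
    nlinarith [mul_pos hε huv]
  have hcases : ∀ Y ∈ S, Y = P ∨ Y = Q ∨ orient P Q Y < 0 ∨ 0 < orient P Q Y := by
    intro Y hY
    by_cases hYP : Y = P
    · exact Or.inl hYP
    by_cases hYQ : Y = Q
    · exact Or.inr (Or.inl hYQ)
    exact Or.inr (Or.inr (lt_or_gt_of_ne
      (hS.orient_ne_zero hP hQ hY hPQ (Ne.symm hYP) (Ne.symm hYQ))))
  have hlow : ∀ Y ∈ S, orient P Q Y < 0 →
      linForm (-v + ε * u) (u + ε * v) Y < linForm (-v + ε * u) (u + ε * v) P := by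
    intro Y hY h
    have h4 := hform ε Y P
    have h5 := h2 Y hY h
    rw [hoP] at h4
    linarith
  have hhigh : ∀ Y ∈ S, 0 < orient P Q Y →
      linForm (-v + ε * u) (u + ε * v) Q < linForm (-v + ε * u) (u + ε * v) Y := by
    intro Y hY h
    have h4 := hform ε Y Q
    have h5 := h3 Y hY h
    rw [hoQ] at h4
    linarith
  refine ⟨-v + ε * u, u + ε * v, ?_, hlt, ?_, ?_⟩
  · intro Y hY Z hZ e
    by_contra hne
    have h4 := h1 Y hY Z hZ hne
    rw [← hform, e, sub_self] at h4
    exact h4 rfl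
  · refine fun Y hY => ⟨fun h => ?_, hlow Y hY⟩
    rcases hcases Y hY with rfl | rfl | h' | h'
    · exact absurd h (lt_irrefl _)
    · exact absurd h hlt.not_gt
    · exact h'
    · exact absurd h (hlt.trans (hhigh Y hY h')).not_gt
  · refine fun Y hY => ⟨fun h => ?_, ?_⟩
    · rcases hcases Y hY with h' | rfl | h' | h'
      · exact Or.inl h'
      · exact absurd h (lt_irrefl _)
      · exact Or.inr h'
      · exact absurd h (hhigh Y hY h').not_gt
    · rintro (rfl | h)
      · exact hlt
      · exact (hlow Y hY h).trans hlt

/-! ### Degrees and the final count -/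

open Classical in
theorem degree_eq_card_filter (S : Finset Plane) [DecidableRel (underlyingGraph S).Adj] (P : S) :
    (underlyingGraph S).degree P = (S.filter fun Y => IsHalvingLine S P Y).card := by
  rw [← SimpleGraph.card_neighborFinset_eq_degree]
  refine Finset.card_bij (fun Y _ => (Y : Plane)) ?_ ?_ ?_
  · intro Y hY
    rw [SimpleGraph.mem_neighborFinset] at hY
    exact Finset.mem_filter.mpr ⟨Y.2, hY⟩
  · exact fun Y _ Z _ h => Subtype.ext h
  · intro Y hY
    obtain ⟨h1, h2⟩ := Finset.mem_filter.mp hY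
    exact ⟨⟨Y, h1⟩, by rw [SimpleGraph.mem_neighborFinset]; exact h2, rfl⟩

open Classical in
theorem card_halving_eq_below_add_above {S : Finset Plane} {g : Plane → ℝ} (hg : Set.InjOn g S)
    {X : Plane} (hX : X ∈ S) :
    (S.filter fun Y => IsHalvingLine S X Y).card =
      (S.filter fun Y => IsHalvingLine S X Y ∧ g Y < g X).card +
      (S.filter fun Y => IsHalvingLine S X Y ∧ g X < g Y).card := by
  rw [← Finset.card_filter_add_card_filter_not
    (s := S.filter fun Y => IsHalvingLine S X Y) (fun Y => g Y < g X), Finset.filter_filter,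
    Finset.filter_filter]
  congr 2
  refine Finset.filter_congr fun Y hY => and_congr_right fun h => ?_
  rw [not_lt]
  exact ⟨fun h' => lt_of_le_of_ne h' fun e => h.2.2.1 (hg hX hY e), le_of_lt⟩

theorem card_orient_neg_add_card_orient_pos {S : Finset Plane} (hS : GeneralPosition S)
    {P Q : Plane} (hP : P ∈ S) (hQ : Q ∈ S) (hPQ : P ≠ Q) :
    (S.filter fun Y => orient P Q Y < 0).card + (S.filter fun Y => 0 < orient P Q Y).card + 2 =
      S.card := by
  have hQ' : Q ∈ S.erase P := Finset.mem_erase.mpr ⟨hPQ.symm, hQ⟩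
  have hoP : orient P Q P = 0 := by unfold orient; ring
  have hoQ : orient P Q Q = 0 := by unfold orient; ring
  rw [← Finset.card_erase_add_one hP, ← Finset.card_erase_add_one hQ',
    ← Finset.card_filter_add_card_filter_not
      (s := (S.erase P).erase Q) (fun Y => orient P Q Y < 0)]
  have h1 : (S.filter fun Y => orient P Q Y < 0) =
      ((S.erase P).erase Q).filter fun Y => orient P Q Y < 0 := by
    ext Y
    simp only [Finset.mem_filter, Finset.mem_erase]
    refine ⟨fun h => ⟨⟨?_, ?_, h.1⟩, h.2⟩, fun h => ⟨h.1.2.2, h.2⟩⟩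
    · rintro rfl; exact h.2.ne hoQ
    · rintro rfl; exact h.2.ne hoP
  have h2 : (S.filter fun Y => 0 < orient P Q Y) =
      ((S.erase P).erase Q).filter fun Y => ¬ orient P Q Y < 0 := by
    ext Y
    simp only [Finset.mem_filter, Finset.mem_erase, not_lt]
    refine ⟨fun h => ⟨⟨?_, ?_, h.1⟩, h.2.le⟩, fun h => ⟨h.1.2.2, lt_of_le_of_ne h.2 ?_⟩⟩
    · rintro rfl; exact h.2.ne' hoQ
    · rintro rfl; exact h.2.ne' hoP
    · exact (hS.orient_ne_zero hP hQ h.1.2.2 hPQ (Ne.symm h.1.2.1) (Ne.symm h.1.1)).symm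
  rw [h1, h2]

theorem isHalvingLine_iff_card {S : Finset Plane} {P Q : Plane}
    (hP : P ∈ S) (hQ : Q ∈ S) (hPQ : P ≠ Q) :
    IsHalvingLine S P Q ↔ (S.filter fun Y => orient P Q Y < 0).card =
      (S.filter fun Y => 0 < orient P Q Y).card := by
  rw [isHalvingLine_iff_sum_sign hP hQ hPQ, sum_sign_eq]
  omega

-- Let `R` be the negative side, and let `p`, `q` be the numbers of halving edges from `R` to `P`
-- and to `Q`. In both cases the degrees are `2p + 1` and `2q + 1`, and `p + q ≤ |R|`, so their sum
-- is at most `2|R| + 2`.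
open Classical in
theorem card_halving_add_card_halving_le {S : Finset Plane} (hS : GeneralPosition S)
    (hn : Even S.card) {P Q : Plane} (hP : P ∈ S) (hQ : Q ∈ S) (hPQ : P ≠ Q)
    (hle : (S.filter fun Y => orient P Q Y < 0).card ≤
      (S.filter fun Y => 0 < orient P Q Y).card) :
    (IsHalvingLine S P Q →
      (S.filter fun Y => IsHalvingLine S P Y).card +
        (S.filter fun Y => IsHalvingLine S Q Y).card ≤ S.card) ∧
    (¬ IsHalvingLine S P Q →
      (S.filter fun Y => IsHalvingLine S P Y).card +
        (S.filter fun Y => IsHalvingLine S Q Y).card + 2 ≤ S.card) := by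
  obtain ⟨α, β, hg, hlt, hbP, hbQ⟩ := exists_linForm_separating hS hP hQ hPQ
  have hcount := card_orient_neg_add_card_orient_pos hS hP hQ hPQ
  have hhalf := isHalvingLine_iff_card hP hQ hPQ
  have habP := card_above_eq_card_below_add_one hS hn hg hP
  have habQ := card_above_eq_card_below_add_one hS hn hg hQ
  have hbaQ := card_below_eq_card_above_add_one hS hn hg hQ
  have hcross := card_crossing_halving hS hn hg (linForm α β P)
  have hdP := card_halving_eq_below_add_above hg hP
  have hdQ := card_halving_eq_below_add_above hg hQ
  set g := linForm α β with hgdef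
  have hRP : (S.filter fun Y => g Y < g P) = S.filter fun Y => orient P Q Y < 0 :=
    Finset.filter_congr hbP
  set R := S.filter fun Y => g Y < g P with hR
  have hPR : P ∉ R := by simp [hR]
  have hRQ : (S.filter fun Y => g Y < g Q) = insert P R := by
    ext Y
    simp only [hR, Finset.mem_filter, Finset.mem_insert]
    constructor
    · rintro ⟨hY, h⟩
      rcases (hbQ Y hY).mp h with h | h
      · exact Or.inl h
      · exact Or.inr ⟨hY, (hbP Y hY).mpr h⟩
    · rintro (rfl | ⟨hY, h⟩)
      · exact ⟨hP, hlt⟩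
      · exact ⟨hY, h.trans hlt⟩
  rw [← hRP] at hle hcount hhalf
  rw [hRQ, Finset.card_insert_of_notMem hPR] at habQ hbaQ
  have hcross := hcross (by omega)
  have hbelowP : (S.filter fun Y => IsHalvingLine S P Y ∧ g Y < g P) =
      R.filter fun Y => IsHalvingLine S Y P := by
    ext Y
    simp only [hR, Finset.mem_filter]
    exact ⟨fun h => ⟨⟨h.1, h.2.2⟩, h.2.1.swap⟩, fun h => ⟨h.1.1, h.2.swap, h.1.2⟩⟩
  have hbelowQ : (S.filter fun Y => IsHalvingLine S Q Y ∧ g Y < g Q) =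
      (insert P R).filter fun Y => IsHalvingLine S Y Q := by
    rw [← hRQ]
    ext Y
    simp only [Finset.mem_filter]
    exact ⟨fun h => ⟨⟨h.1, h.2.2⟩, h.2.1.swap⟩, fun h => ⟨h.1.1, h.2.swap, h.1.2⟩⟩
  -- Edges from `R` to `P` or `Q` are among the `|R|` edges that leave `R`.
  have hbound : (R.filter fun Y => IsHalvingLine S Y P).card +
      (R.filter fun Y => IsHalvingLine S Y Q).card ≤ R.card := by
    rw [← hcross, Finset.card_filter, Finset.card_filter, ← Finset.sum_add_distrib]
    refine Finset.sum_le_sum fun Y _ => ?_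
    have hsub : (({P, Q} : Finset Plane).filter fun Z => IsHalvingLine S Y Z) ⊆
        S.filter fun Z => IsHalvingLine S Y Z ∧ g P ≤ g Z := by
      intro Z hZ
      simp only [Finset.mem_filter, Finset.mem_insert, Finset.mem_singleton] at hZ ⊢
      refine ⟨hZ.2.2.1, hZ.2, ?_⟩
      rcases hZ.1 with rfl | rfl
      · exact le_rfl
      · exact hlt.le
    have h := Finset.card_le_card hsub
    rwa [Finset.card_filter, Finset.sum_pair hPQ] at h
  rw [hbelowP] at hdP habP
  rw [hbelowQ, Finset.filter_insert] at hdQ habQ hbaQ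
  obtain ⟨m, hm⟩ := hn
  constructor
  · intro hH
    have h1 := hhalf.mp hH
    rw [if_pos hH, Finset.card_insert_of_notMem (by simp [hPR])] at hdQ hbaQ
    have h2 := habP (by omega)
    have h3 := hbaQ (by omega)
    omega
  · intro hH
    -- The sides differ and `n` is even, so they differ by at least 2. Thus `2|R| + 4 ≤ n`, and `Q`
    -- is still in the lower half.
    have h1 : R.card ≠ _ := fun h => hH (hhalf.mpr h)
    rw [if_neg hH] at hdQ habQ
    have h2 := habP (by omega)
    have h3 := habQ (by omega)
    omega

theorem mainTheorem9 (S : Finset Plane) (hS : GeneralPosition S) (hn : Even S.card)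
    [DecidableRel (underlyingGraph S).Adj] (P Q : S) (hPQ : P ≠ Q) :
    ((underlyingGraph S).Adj P Q →
      (underlyingGraph S).degree P + (underlyingGraph S).degree Q ≤ S.card) ∧
    (¬ (underlyingGraph S).Adj P Q →
      (underlyingGraph S).degree P + (underlyingGraph S).degree Q + 2 ≤ S.card) := by
  have hne : (P : Plane) ≠ Q := fun h => hPQ (Subtype.ext h)
  have hadj : (underlyingGraph S).Adj P Q ↔ IsHalvingLine S P Q := Iff.rfl
  rw [degree_eq_card_filter, degree_eq_card_filter, hadj]
  rcases le_total (S.filter fun Y => orient P Q Y < 0).card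
    (S.filter fun Y => 0 < orient P Q Y).card with h | h
  · exact card_halving_add_card_halving_le hS hn P.2 Q.2 hne h
  -- Exchanging `P` and `Q` reverses the orientation, so the smaller side becomes the negative one.
  · have hswap : IsHalvingLine S P Q ↔ IsHalvingLine S Q P :=
      ⟨IsHalvingLine.swap, IsHalvingLine.swap⟩
    rw [add_comm (Finset.card _), hswap]
    refine card_halving_add_card_halving_le hS hn Q.2 P.2 hne.symm ?_
    simpa only [orient_swap (P : Plane) Q, Left.neg_pos_iff, Left.neg_neg_iff] using h
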